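/- Let $(X,\|\cdot\|)$ be a (real or complex) Banach space and let $\tau$ be a locally convex Hausdorff topology on $X$ such that $(X,\|\cdot\|,\tau)$ is a bi-admissible space, i.e.: $\tau$ is coarser than the norm topology; every $\|\cdot\|$-bounded $\tau$-Cauchy sequence is $\tau$-convergent; and $\|x\|=\sup\{|\varphi(x)| : \varphi\in(X,\tau)',\ \|\varphi\|\le 1\}$ for all $x\in X$. A fundamental system of seminorms for $\tau$ is a set $\Gamma$ of $\tau$-continuous seminorms on $X$ such that every $\tau$-neighbourhood of $0$ contains $\{x\in X : p(x)<\varepsilon\}$ for some $p\in\Gamma$ and $\varepsilon>0$; it is norming if $\|x\|=\sup_{p\in\Gamma}p(x)$ for all $x\in X$. A family $(T(t))_{t\ge 0}$ of bounded linear operators on $X$ is a bi-continuous semigroup if 1. $T(0)=I$ and $T(t+s)=T(t)T(s)$ for all $s,t\ge0$; 2. $t\mapsto T(t)x$ is $\tau$-continuous on $[0,\infty)$ for every $x\in X$; 3. there are $M\ge1$ and $\omega\in\mathbb R$ with $\|T(t)\|\le Me^{\omega t}$ for all $t\ge0$; 4. for every norm-bounded sequence $(x_n)_{n\in\mathbb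 N}$ with $x_n\to0$ in $\tau$ and every $t_0\ge0$, $T(s)x_n\to0$ in $\tau$ uniformly for $s\in[0,t_0]$. It is a contraction semigroup if moreover $\|T(t)\|\le1$ for all $t\ge0$. Its generator is the operator whose domain consists of all $x\in X$ for which $\tau\text{-}\lim_{t\to0}\frac{T(t)x-x}{t}$ exists and $\sup_{t\in(0,1]}\frac{\|T(t)x-x\|}{t}<\infty$, and which maps such an $x$ to this limit. Let $A\colon D(A)\subseteq X\to X$ be a linear operator that is closed with respect to the norm and bi-densely defined, i.e. for every $x\in X$ there is a norm-bounded sequence in $D(A)$ that $\tau$-converges to $x$. The operator $A$ is called bi-dissipative if there is a norming fundamental system of seminorms $\Gamma$ for $\tau$ such that $p((\lambda-A)x)\ge\lambda p(x)$ for all $\lambda>0$, $p\in\Gamma$ and $x\in D(A)$. Then the following statements are equivalent. (a) $A$ is the generator of a bi-continuous contraction semigroup $(T(t))_{t\ge0}$, and there is a norming fundamental system of seminorms $\Gamma$ for $\tau$ such that $p(T(t)x)\le p(x)$ for all $t\ge0$, $p\in\Gamma$ and $x\in X$. (b) $A$ is bi-dissipative and $\lambda-A\colon D(A)\to X$ is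 surjective for some $\lambda>0$. -/

import Mathlib

open Filter Set
open scoped Topology NNReal

namespace BiContinuous

/-- A second topology `τ` on `X`. It is wrapped in a structure so that instance search
never mistakes it for the norm topology: every topological notion below refers to the norm
topology unless `τ.top` is written explicitly. -/
structure SecondTopology (X : Type*) where
  top : TopologicalSpace X

variable {𝕜 X : Type*} [RCLike 𝕜] [NormedAddCommGroup X] [NormedSpace 𝕜 X]

/-- `(X, ‖·‖, τ)` is a bi-admissible space. The norm topology is the one carried by the instances
on `X`; the coarser locally convex topology is the explicit argument `τ`. -/
structure IsBiAdmissible (𝕜 : Type*) {X : Type*} [RCLike 𝕜] [NormedAddCommGroup X]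
    [NormedSpace 𝕜 X] (τ : SecondTopology X) : Prop where
  /-- `X` is a Banach space. -/
  complete : CompleteSpace X
  /-- `τ` is a locally convex vector space topology, that is, it is induced by seminorms. -/
  locallyConvex : @PolynormableSpace 𝕜 X _ _ _ τ.top
  hausdorff : @T2Space X τ.top
  /-- The identity map from the norm topology to `τ` is continuous. -/
  coarser : Continuous[inferInstance, τ.top] (id : X → X)
  /-- Every norm-bounded `τ`-Cauchy sequence is `τ`-convergent. -/
  seqComplete : ∀ u : ℕ → X, (∃ C : ℝ, ∀ n, ‖u n‖ ≤ C) →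
    (∀ U ∈ @nhds X τ.top 0, ∃ N : ℕ, ∀ m ≥ N, ∀ n ≥ N, u m - u n ∈ U) →
    ∃ x : X, Tendsto u atTop (@nhds X τ.top x)
  /-- The dual of `(X, τ)` is norming. As `τ` is coarser than the norm topology, the `τ`-continuous
  functionals are the norm-continuous functionals that are moreover `τ`-continuous. -/
  norming : ∀ x : X,
    IsLUB {r : ℝ | ∃ φ : X →L[𝕜] 𝕜, Continuous[τ.top, inferInstance] φ ∧ ‖φ‖ ≤ 1 ∧ r = ‖φ x‖} ‖x‖

/-- `Γ` is a fundamental system of seminorms for `τ`: its members are `τ`-continuous and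
their balls around `0` form a neighbourhood basis of `0` for `τ`. -/
def IsFundamentalSystem (τ : SecondTopology X) (Γ : Set (Seminorm 𝕜 X)) : Prop :=
  (∀ p ∈ Γ, Continuous[τ.top, inferInstance] p) ∧
    ∀ U ∈ @nhds X τ.top 0, ∃ p ∈ Γ, ∃ ε : ℝ, 0 < ε ∧ {x : X | p x < ε} ⊆ U

/-- `‖x‖ = sup_{p ∈ Γ} p x` for all `x`. -/
def IsNorming (Γ : Set (Seminorm 𝕜 X)) : Prop :=
  ∀ x : X, IsLUB {r : ℝ | ∃ p ∈ Γ, r = p x} ‖x‖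

/-- The family of bounded operators `(T t)_{t ≥ 0}` is a bi-continuous semigroup. -/
structure IsBiContinuousSemigroup (τ : SecondTopology X) (T : ℝ≥0 → X →L[𝕜] X) : Prop where
  zero : T 0 = ContinuousLinearMap.id 𝕜 X
  add : ∀ t s : ℝ≥0, T (t + s) = (T t).comp (T s)
  stronglyContinuous : ∀ x : X, Continuous[inferInstance, τ.top] fun t : ℝ≥0 => T t x
  expBounded : ∃ M ω : ℝ, 1 ≤ M ∧ ∀ t : ℝ≥0, ‖T t‖ ≤ M * Real.exp (ω * t)
  locallyBiEquicontinuous : ∀ u : ℕ → X, (∃ C : ℝ, ∀ n, ‖u n‖ ≤ C) →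
    Tendsto u atTop (@nhds X τ.top 0) →
    ∀ t₀ : ℝ≥0, ∀ U ∈ @nhds X τ.top 0, ∀ᶠ n in atTop, ∀ s ≤ t₀, T s (u n) ∈ U

/-- `(T t)_{t ≥ 0}` is a contraction semigroup. -/
def IsContractive (T : ℝ≥0 → X →L[𝕜] X) : Prop :=
  ∀ t : ℝ≥0, ‖T t‖ ≤ 1

/-- The difference quotient `(T t x - x) / t`. -/
noncomputable def diffQuotient (T : ℝ≥0 → X →L[𝕜] X) (x : X) (t : ℝ≥0) : X :=
  (((t : ℝ) : 𝕜)⁻¹) • (T t x - x)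

/-- The operator `A` is the generator of `T`: its domain consists of all `x` for which the
difference quotients `τ`-converge as `t → 0` and are norm-bounded for `t ∈ (0, 1]`,
and on this domain `A x` is the `τ`-limit. -/
def IsGenerator (τ : SecondTopology X) (T : ℝ≥0 → X →L[𝕜] X) (A : X →ₗ.[𝕜] X) : Prop :=
  (∀ x : X, x ∈ A.domain ↔
    (∃ y : X, Tendsto (diffQuotient T x) (𝓝[>] 0) (@nhds X τ.top y)) ∧
      ∃ C : ℝ, ∀ t : ℝ≥0, 0 < t → t ≤ 1 → ‖T t x - x‖ / t ≤ C) ∧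
  ∀ x : A.domain, Tendsto (diffQuotient T (x : X)) (𝓝[>] 0) (@nhds X τ.top (A x))

/-- `A` is bi-densely defined: every point of `X` is the `τ`-limit of a norm-bounded sequence
in the domain of `A`. -/
def IsBiDenselyDefined (τ : SecondTopology X) (A : X →ₗ.[𝕜] X) : Prop :=
  ∀ x : X, ∃ u : ℕ → X, (∀ n, u n ∈ A.domain) ∧ (∃ C : ℝ, ∀ n, ‖u n‖ ≤ C) ∧
    Tendsto u atTop (@nhds X τ.top x)

/-- The operator `l - A` on the domain of `A`, for a real number `l`. -/
noncomputable def shift (A : X →ₗ.[𝕜] X) (l : ℝ) (x : A.domain) : X :=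
  (l : 𝕜) • (x : X) - A x

/-- `A` is bi-dissipative. -/
def IsBiDissipative (τ : SecondTopology X) (A : X →ₗ.[𝕜] X) : Prop :=
  ∃ Γ : Set (Seminorm 𝕜 X), IsFundamentalSystem τ Γ ∧
    (∀ l : ℝ, 0 < l → ∀ p ∈ Γ, ∀ x : A.domain, l * p (x : X) ≤ p (shift A l x)) ∧
    IsNorming Γ

end BiContinuous

/-! Both implications approximate `A` on its domain by commuting bounded operators `B = c (N - 1)`,
where `c ≥ 0` and `N` is a contraction for every seminorm in `Γ`: Yosida approximations
`λ (λ R(λ, A) - 1)` to construct the semigroup from `A`, difference quotients `(T h - 1) / h` to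
construct the resolvent from `T`, in place of the Laplace transform and its `τ`-valued integrals.

Such an operator generates the semigroup `e^{tB} = e^{-tc} e^{tcN}` and has the resolvent
`(1 - B)⁻¹`, both contractive for every `p ∈ Γ`. If `B` and `B'` commute, then at a point `x` the
two semigroups differ by at most `t * p (B x - B' x)`, and the two resolvents by at most
`p (B x - B' x)`. Hence both converge on the domain of `A` and, by contractivity, density and
bounded sequential completeness, everywhere. A limit semigroup `T` has a generator extending `A`,
and the extension is not proper, because `λ - A` is surjective while `λ` minus the generator is
injective. A limit resolvent `K` commutes with `T`, and `(K x, K x - x)` lies in the graph of the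
generator for `x` in its domain, hence for all `x`, because the graph is closed. -/

namespace BiContinuous

section SeminormConvergence

variable {𝕜 X : Type*} [RCLike 𝕜] [NormedAddCommGroup X] [NormedSpace 𝕜 X]
  {Γ : Set (Seminorm 𝕜 X)} {ι κ : Type*} {l : Filter ι} {u v : ι → X} {x y : X}

theorem seminorm_ofReal_smul (p : Seminorm 𝕜 X) {r : ℝ} (hr : 0 ≤ r) (x : X) :
    p ((r : 𝕜) • x) = r * p x := by
  rw [map_smul_eq_mul, RCLike.norm_of_nonneg hr]

theorem IsNorming.le_norm (hN : IsNorming Γ) {p : Seminorm 𝕜 X} (hp : p ∈ Γ) (x : X) :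
    p x ≤ ‖x‖ :=
  (hN x).1 ⟨p, hp, rfl⟩

theorem IsNorming.norm_le (hN : IsNorming Γ) {c : ℝ} (h : ∀ p ∈ Γ, p x ≤ c) : ‖x‖ ≤ c :=
  (hN x).2 (by rintro _ ⟨p, hp, rfl⟩; exact h p hp)

theorem IsNorming.eq_zero (hN : IsNorming Γ) (h : ∀ p ∈ Γ, p x ≤ 0) : x = 0 :=
  norm_le_zero_iff.1 (hN.norm_le h)

theorem IsNorming.continuous (hN : IsNorming Γ) {p : Seminorm 𝕜 X} (hp : p ∈ Γ) :
    Continuous p :=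
  Seminorm.continuous_of_le (q := normSeminorm 𝕜 X) continuous_norm (hN.le_norm hp)

/-- Convergence of `u` to `x` along `l` with respect to every seminorm in `Γ`. For a fundamental
system `Γ` of `τ` this is `τ`-convergence; stated through seminorms, it does not compete with the
norm topology for instances. -/
def SeminormTendsto (Γ : Set (Seminorm 𝕜 X)) (u : ι → X) (l : Filter ι) (x : X) : Prop :=
  ∀ p ∈ Γ, Tendsto (fun i => p (u i - x)) l (𝓝 0)

/-- Every norm-bounded sequence that is Cauchy for all seminorms in `Γ` converges for all of them:
the third axiom of a bi-admissible space, in terms of `Γ`. -/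
def IsBoundedlyComplete (Γ : Set (Seminorm 𝕜 X)) : Prop :=
  ∀ u : ℕ → X, (∃ C : ℝ, ∀ n, ‖u n‖ ≤ C) →
    SeminormTendsto Γ (fun q : ℕ × ℕ => u q.1 - u q.2) atTop 0 → ∃ x, SeminormTendsto Γ u atTop x

/-- Density of `D` with respect to the seminorms in `Γ`, expressed by filters on `D` because the
points of `X` need not be limits of sequences in `D`. -/
def IsSeminormDense (Γ : Set (Seminorm 𝕜 X)) (D : Set X) : Prop :=
  ∀ x, ∃ l : Filter D, l.NeBot ∧ SeminormTendsto Γ Subtype.val l x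

theorem seminormTendsto_iff_eventually_le :
    SeminormTendsto Γ u l x ↔ ∀ p ∈ Γ, ∀ ε : ℝ, 0 < ε → ∀ᶠ i in l, p (u i - x) ≤ ε := by
  refine ⟨fun h p hp ε hε => (h p hp).eventually_le_const hε, fun h p hp => ?_⟩
  refine Metric.tendsto_nhds.2 fun ε hε => (h p hp (ε / 2) (half_pos hε)).mono fun i hi => ?_
  rw [Real.dist_0_eq_abs, abs_of_nonneg (apply_nonneg p _)]
  linarith

namespace SeminormTendsto

theorem of_tendsto (hN : IsNorming Γ) (h : Tendsto u l (𝓝 x)) : SeminormTendsto Γ u l x :=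
  fun p hp => by
    simpa [Function.comp_def] using
      ((hN.continuous hp).tendsto 0).comp (tendsto_sub_nhds_zero_iff.2 h)

theorem const (x : X) : SeminormTendsto Γ (fun _ : ι => x) l x :=
  fun p _ => by simpa using tendsto_const_nhds

theorem comp (hu : SeminormTendsto Γ u l x) {f : κ → ι} {l' : Filter κ} (hf : Tendsto f l' l) :
    SeminormTendsto Γ (fun k => u (f k)) l' x :=
  fun p hp => (hu p hp).comp hf

theorem of_le (hu : SeminormTendsto Γ u l x) (h : ∀ p ∈ Γ, ∀ i, p (v i - y) ≤ p (u i - x)) :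
    SeminormTendsto Γ v l y :=
  fun p hp => squeeze_zero (fun _ => apply_nonneg p _) (h p hp) (hu p hp)

theorem add (hu : SeminormTendsto Γ u l x) (hv : SeminormTendsto Γ v l y) :
    SeminormTendsto Γ (fun i => u i + v i) l (x + y) := fun p hp => by
  refine squeeze_zero (fun i => apply_nonneg p _) (fun i => ?_)
    (by simpa using (hu p hp).add (hv p hp))
  rw [add_sub_add_comm]
  exact map_add_le_add p _ _

theorem smul (c : 𝕜) (hu : SeminormTendsto Γ u l x) :
    SeminormTendsto Γ (fun i => c • u i) l (c • x) := fun p hp => by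
  simpa [← smul_sub, map_smul_eq_mul] using (hu p hp).const_mul ‖c‖

theorem sub (hu : SeminormTendsto Γ u l x) (hv : SeminormTendsto Γ v l y) :
    SeminormTendsto Γ (fun i => u i - v i) l (x - y) := by
  simpa [sub_eq_add_neg] using hu.add (hv.smul (-1))

theorem cauchy {u : ℕ → X} (hu : SeminormTendsto Γ u atTop x) :
    SeminormTendsto Γ (fun q : ℕ × ℕ => u q.1 - u q.2) atTop 0 := by
  rw [← prod_atTop_atTop_eq, ← sub_self x]
  exact (hu.comp tendsto_fst).sub (hu.comp tendsto_snd)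

theorem tendsto_apply (hu : SeminormTendsto Γ u l x) {p : Seminorm 𝕜 X} (hp : p ∈ Γ) :
    Tendsto (fun i => p (u i)) l (𝓝 (p x)) :=
  tendsto_sub_nhds_zero_iff.1 <|
    squeeze_zero_norm (fun i => by simpa using abs_sub_map_le_sub p (u i) x) (hu p hp)

theorem unique [l.NeBot] (hN : IsNorming Γ) (hx : SeminormTendsto Γ u l x)
    (hy : SeminormTendsto Γ u l y) : x = y := by
  refine sub_eq_zero.1 (hN.eq_zero fun p hp => ?_)
  refine (tendsto_nhds_unique ((hx.sub hy).tendsto_apply hp) ?_).le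
  simp

theorem of_prod_top {l' : Filter κ} [l'.NeBot] {F : ι → κ → X} {G : ι → X}
    (hF : SeminormTendsto Γ (fun q : ι × κ => F q.1 q.2) (l ×ˢ ⊤) x)
    (hG : ∀ i, SeminormTendsto Γ (F i) l' (G i)) : SeminormTendsto Γ G l x := by
  rw [seminormTendsto_iff_eventually_le] at hF ⊢
  intro p hp ε hε
  have hF' := hF p hp ε hε
  rw [← principal_univ, eventually_prod_principal_iff] at hF'
  filter_upwards [hF'] with i hi
  exact le_of_tendsto' (((hG i).sub (const x)).tendsto_apply hp) fun k => hi k (mem_univ k)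

end SeminormTendsto

end SeminormConvergence

section Contraction

variable {𝕜 X : Type*} [RCLike 𝕜] [NormedAddCommGroup X] [NormedSpace 𝕜 X]
  {Γ : Set (Seminorm 𝕜 X)} {ι : Type*} {l : Filter ι} {x y : X}

/-- `N` is a contraction for every seminorm in `Γ`. -/
def IsSeminormContraction (Γ : Set (Seminorm 𝕜 X)) (N : X →L[𝕜] X) : Prop :=
  ∀ p ∈ Γ, ∀ x, p (N x) ≤ p x

theorem IsSeminormContraction.norm_le_one {N : X →L[𝕜] X} (h : IsSeminormContraction Γ N)
    (hN : IsNorming Γ) : ‖N‖ ≤ 1 :=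
  N.opNorm_le_bound zero_le_one fun x =>
    hN.norm_le fun p hp => (h p hp x).trans (by simpa using hN.le_norm hp x)

theorem IsSeminormContraction.pow {N : X →L[𝕜] X} (h : IsSeminormContraction Γ N) (n : ℕ) :
    IsSeminormContraction Γ (N ^ n) := by
  induction n with
  | zero => exact fun _ _ _ => le_rfl
  | succ n ih =>
    intro p hp x
    rw [pow_succ']
    exact (h p hp _).trans (ih p hp x)

theorem IsSeminormContraction.of_tendsto [l.NeBot] {N : ι → X →L[𝕜] X} {K : X →L[𝕜] X}
    (h : ∀ i, IsSeminormContraction Γ (N i))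
    (hK : ∀ x, SeminormTendsto Γ (fun i => N i x) l (K x)) :
    IsSeminormContraction Γ K := fun p hp x =>
  le_of_tendsto' ((hK x).tendsto_apply hp) fun i => h i p hp x

theorem SeminormTendsto.map_contraction {N : ι → X →L[𝕜] X} {u : ι → X}
    (hx : SeminormTendsto Γ (fun i => N i x) l y) (hN : ∀ i, IsSeminormContraction Γ (N i))
    (hu : SeminormTendsto Γ u l x) : SeminormTendsto Γ (fun i => N i (u i)) l y := by
  have h : SeminormTendsto Γ (fun i => N i (u i - x)) l 0 :=
    hu.of_le fun p hp i => by simpa using hN i p hp (u i - x)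
  simpa using h.add hx

theorem SeminormTendsto.map {K : X →L[𝕜] X} {u : ι → X} (hu : SeminormTendsto Γ u l x)
    (hK : IsSeminormContraction Γ K) : SeminormTendsto Γ (fun i => K (u i)) l (K x) :=
  (const (K x)).map_contraction (fun _ => hK) hu

theorem seminormTendsto_zero_of_dense {D : Set X} (hD : IsSeminormDense Γ D)
    {S : ι → X →L[𝕜] X} {C : ℝ} (hS : ∀ p ∈ Γ, ∀ i x, p (S i x) ≤ C * p x)
    (h : ∀ v ∈ D, SeminormTendsto Γ (fun i => S i v) l 0) (x : X) :
    SeminormTendsto Γ (fun i => S i x) l 0 := by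
  refine seminormTendsto_iff_eventually_le.2 fun p hp ε hε => ?_
  obtain ⟨v, hv, hvx⟩ : ∃ v ∈ D, C * p (v - x) ≤ ε / 2 := by
    obtain ⟨m, hm, hmx⟩ := hD x
    have hlim : Tendsto (fun v : D => C * p (v - x)) m (𝓝 0) := by
      simpa using (hmx p hp).const_mul C
    obtain ⟨v, hv⟩ := (hlim.eventually_le_const (half_pos hε)).exists
    exact ⟨v, v.2, hv⟩
  filter_upwards [seminormTendsto_iff_eventually_le.1 (h v hv) p hp (ε / 2) (half_pos hε)] with i hi
  calc p (S i x - 0) ≤ p (S i v - S i x) + p (S i v - 0) := by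
        rw [map_sub_rev p (S i v) (S i x)]
        exact le_map_sub_add_map_sub p _ _ _
    _ ≤ C * p (v - x) + p (S i v - 0) := by
        rw [← map_sub]
        gcongr
        exact hS p hp i _
    _ ≤ ε := by linarith

theorem exists_limit_operator [l.NeBot] (hN : IsNorming Γ) {S : ι → X →L[𝕜] X}
    (hS : ∀ i, IsSeminormContraction Γ (S i))
    (h : ∀ x, ∃ y, SeminormTendsto Γ (fun i => S i x) l y) :
    ∃ K : X →L[𝕜] X, ∀ x, SeminormTendsto Γ (fun i => S i x) l (K x) := by
  choose K hK using h
  have hK_add x y : K (x + y) = K x + K y :=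
    (hK (x + y)).unique hN (by simpa using (hK x).add (hK y))
  have hK_smul (c : 𝕜) x : K (c • x) = c • K x :=
    (hK (c • x)).unique hN (by simpa using (hK x).smul c)
  refine ⟨LinearMap.mkContinuous ⟨⟨K, hK_add⟩, hK_smul⟩ 1 fun x => ?_, hK⟩
  refine hN.norm_le fun p hp => (le_of_tendsto' ((hK x).tendsto_apply hp) fun i => ?_)
  simpa using (hS i p hp x).trans (hN.le_norm hp x)

theorem exists_limit_operator_of_dense (hN : IsNorming Γ) (hC : IsBoundedlyComplete Γ)
    {D : Set X} (hD : IsSeminormDense Γ D) {S : ℕ → X →L[𝕜] X}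
    (hS : ∀ n, IsSeminormContraction Γ (S n))
    (h : ∀ v ∈ D, SeminormTendsto Γ (fun q : ℕ × ℕ => S q.1 v - S q.2 v) atTop 0) :
    ∃ K : X →L[𝕜] X, ∀ x, SeminormTendsto Γ (fun n => S n x) atTop (K x) := by
  refine exists_limit_operator hN hS fun x => hC _ ⟨‖x‖, fun n => ?_⟩ ?_
  · exact hN.norm_le fun p hp => (hS n p hp x).trans (hN.le_norm hp x)
  · refine seminormTendsto_zero_of_dense hD (S := fun q : ℕ × ℕ => S q.1 - S q.2) (C := 2)
      (fun p hp q x => ?_) h x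
    calc p (S q.1 x - S q.2 x) ≤ p (S q.1 x) + p (S q.2 x) := map_sub_le_add p _ _
      _ ≤ p x + p x := add_le_add (hS q.1 p hp x) (hS q.2 p hp x)
      _ = 2 * p x := (two_mul _).symm

theorem seminormTendsto_self_of_dense {D : Set X} (hD : IsSeminormDense Γ D)
    {S : ι → X →L[𝕜] X} (hS : ∀ i, IsSeminormContraction Γ (S i))
    (h : ∀ v ∈ D, SeminormTendsto Γ (fun i => S i v) l v) (x : X) :
    SeminormTendsto Γ (fun i => S i x) l x := by
  have hzero : SeminormTendsto Γ (fun i => (S i - 1) x) l 0 := by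
    refine seminormTendsto_zero_of_dense hD (C := 2) (fun p hp i x => ?_) (fun v hv => ?_) x
    · calc p (S i x - x) ≤ p (S i x) + p x := map_sub_le_add p _ _
        _ ≤ 2 * p x := by linarith [hS i p hp x]
    · simpa using (h v hv).sub (.const v)
  simpa using hzero.add (.const x)

end Contraction

section Semigroup

theorem tendsto_div_nat_nhdsGT {t : ℝ≥0} (ht : 0 < t) :
    Tendsto (fun n : ℕ => t / (n + 1)) atTop (𝓝[>] 0) :=
  tendsto_nhdsWithin_iff.2
    ⟨by simpa [div_eq_mul_inv] using tendsto_one_div_add_atTop_nhds_zero_nat.const_mul t,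
      .of_forall fun n => div_pos ht (by positivity)⟩

theorem le_mul_of_forall_add_le {f b : ℝ≥0 → ℝ} {c : ℝ} {t : ℝ≥0} (h0 : f 0 ≤ 0)
    (hf : ∀ s h, 0 < h → s + h ≤ t → f (s + h) ≤ f s + h * b h)
    (hb : Tendsto b (𝓝[>] 0) (𝓝 c)) : f t ≤ t * c := by
  obtain rfl | ht := eq_zero_or_pos t
  · simpa using h0
  refine ge_of_tendsto' ((hb.comp (tendsto_div_nat_nhdsGT ht)).const_mul (t : ℝ)) fun n => ?_
  set h : ℝ≥0 := t / (n + 1)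
  have hh : 0 < h := div_pos ht (by positivity)
  have hnt : (n + 1) * h = t := mul_div_cancel₀ t (by positivity)
  have hk : ∀ k : ℕ, k ≤ n + 1 → f (k * h) ≤ k * (h * b h) := by
    intro k
    induction k with
    | zero => simpa using h0
    | succ k ih =>
      intro hkn
      have hle : k * h + h ≤ t := by
        rw [← hnt, ← add_one_mul]
        gcongr
        exact_mod_cast Nat.le_of_succ_le_succ hkn
      calc f ((k + 1 : ℕ) * h) = f (k * h + h) := by push_cast; rw [add_one_mul]
        _ ≤ f (k * h) + h * b h := hf _ h hh hle
        _ ≤ k * (h * b h) + h * b h := by gcongr; exact ih (by lia)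
        _ = (k + 1 : ℕ) * (h * b h) := by push_cast; ring
  calc f t = f ((n + 1 : ℕ) * h) := by push_cast; rw [hnt]
    _ ≤ (n + 1 : ℕ) * (h * b h) := hk (n + 1) le_rfl
    _ = ((n + 1) * h : ℝ≥0) * b h := by push_cast; ring
    _ = t * b h := by rw [hnt]

variable {𝕜 X : Type*} [RCLike 𝕜] [NormedAddCommGroup X] [NormedSpace 𝕜 X]
  {Γ : Set (Seminorm 𝕜 X)} {ι : Type*} {S S' : ℝ≥0 → X →L[𝕜] X} {x x' y y' : X} {t : ℝ≥0}

theorem smul_diffQuotient (S : ℝ≥0 → X →L[𝕜] X) (x : X) (ht : 0 < t) :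
    ((t : ℝ) : 𝕜) • diffQuotient S x t = S t x - x :=
  smul_inv_smul₀ (by exact_mod_cast ht.ne') _

theorem map_diffQuotient {K : X →L[𝕜] X} (hK : Commute K (S t)) (x : X) :
    K (diffQuotient S x t) = diffQuotient S (K x) t := by
  have hKx : K (S t x) = S t (K x) := DFunLike.congr_fun hK.eq x
  rw [diffQuotient, map_smul, map_sub, hKx, diffQuotient]

/-- `S` is a semigroup of contractions for every seminorm in `Γ`, without any continuity in time. -/
structure IsSeminormContractionSemigroup (Γ : Set (Seminorm 𝕜 X)) (S : ℝ≥0 → X →L[𝕜] X) :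
    Prop where
  zero : S 0 = 1
  add : ∀ s t, S (s + t) = S s * S t
  contraction : ∀ t, IsSeminormContraction Γ (S t)

/-- The orbit of `x` under `S` has derivative `y` at time `0`, with respect to `Γ`: the pair
`(x, y)` lies in the graph of the generator of `S`. -/
def HasOrbitDeriv (Γ : Set (Seminorm 𝕜 X)) (S : ℝ≥0 → X →L[𝕜] X) (x y : X) : Prop :=
  SeminormTendsto Γ (diffQuotient S x) (𝓝[>] 0) y

theorem HasOrbitDeriv.sub (hx : HasOrbitDeriv Γ S x y) (hx' : HasOrbitDeriv Γ S x' y') :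
    HasOrbitDeriv Γ S (x - x') (y - y') := by
  refine (SeminormTendsto.sub hx hx').of_le fun p _ t => le_of_eq ?_
  rw [diffQuotient, diffQuotient, diffQuotient, ← smul_sub, map_sub (S t), sub_sub_sub_comm]

theorem HasOrbitDeriv.map {K : X →L[𝕜] X} (hx : HasOrbitDeriv Γ S x y)
    (hK : IsSeminormContraction Γ K) (hKS : ∀ t, Commute K (S t)) :
    HasOrbitDeriv Γ S (K x) (K y) := by
  simpa only [HasOrbitDeriv, map_diffQuotient (hKS _)] using SeminormTendsto.map hx hK

theorem IsSeminormContractionSemigroup.id : IsSeminormContractionSemigroup Γ fun _ => 1 :=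
  ⟨rfl, fun _ _ => (mul_one _).symm, fun _ _ _ _ => le_rfl⟩

theorem HasOrbitDeriv.id (x : X) : HasOrbitDeriv Γ (fun _ => (1 : X →L[𝕜] X)) x 0 := by
  have h t : diffQuotient (fun _ => (1 : X →L[𝕜] X)) x t = 0 := by simp [diffQuotient]
  rw [HasOrbitDeriv, funext h]
  exact .const 0

namespace IsSeminormContractionSemigroup

theorem commute (hS : IsSeminormContractionSemigroup Γ S) (s t : ℝ≥0) :
    Commute (S s) (S t) := by
  rw [commute_iff_eq, ← hS.add, add_comm, hS.add]

theorem apply_sub_apply_le (hS : IsSeminormContractionSemigroup Γ S)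
    (hS' : IsSeminormContractionSemigroup Γ S') (hSS' : ∀ s t, Commute (S s) (S' t))
    (hx : HasOrbitDeriv Γ S x y) (hx' : HasOrbitDeriv Γ S' x y') {p : Seminorm 𝕜 X} (hp : p ∈ Γ)
    (t : ℝ≥0) : p (S t x - S' t x) ≤ t * p (y - y') := by
  refine le_mul_of_forall_add_le (f := fun t => p (S t x - S' t x)) (by simp [hS.zero, hS'.zero])
    (fun s h hh _ => ?_) ((SeminormTendsto.sub hx hx').tendsto_apply hp)
  have hstep : S h x - S' h x =
      ((h : ℝ) : 𝕜) • (diffQuotient S x h - diffQuotient S' x h) := by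
    rw [smul_sub, smul_diffQuotient S x hh, smul_diffQuotient S' x hh, sub_sub_sub_cancel_right]
  have hsplit : S (s + h) x - S' (s + h) x =
      S' h (S s x - S' s x) + S s (S h x - S' h x) := by
    have hcomm : S s (S' h x) = S' h (S s x) := DFunLike.congr_fun (hSS' s h).eq x
    rw [hS.add, add_comm, hS'.add, map_sub, map_sub, hcomm]
    exact (sub_add_sub_cancel' _ _ _).symm
  calc p (S (s + h) x - S' (s + h) x) ≤ p (S s x - S' s x) + p (S h x - S' h x) := by
        rw [hsplit]
        exact (map_add_le_add p _ _).trans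
          (add_le_add (hS'.contraction h p hp _) (hS.contraction s p hp _))
    _ = p (S s x - S' s x) + h * p (diffQuotient S x h - diffQuotient S' x h) := by
        rw [hstep, seminorm_ofReal_smul p h.coe_nonneg]

theorem apply_sub_self_le (hS : IsSeminormContractionSemigroup Γ S) (hx : HasOrbitDeriv Γ S x y)
    {p : Seminorm 𝕜 X} (hp : p ∈ Γ) (t : ℝ≥0) : p (S t x - x) ≤ t * p y := by
  simpa using hS.apply_sub_apply_le .id (fun s _ => Commute.one_right (S s)) hx (.id x) hp t

theorem apply_sub_sub_smul_le (hS : IsSeminormContractionSemigroup Γ S)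
    (hx : HasOrbitDeriv Γ S x y) {p : Seminorm 𝕜 X} (hp : p ∈ Γ) {c : ℝ}
    (hc : ∀ s ≤ t, p (S s y - y) ≤ c) : p (S t x - x - ((t : ℝ) : 𝕜) • y) ≤ t * c := by
  have hb : Tendsto (fun h => p (diffQuotient S x h - y) + c) (𝓝[>] 0) (𝓝 c) := by
    simpa using (hx p hp).add_const c
  refine le_mul_of_forall_add_le (f := fun t => p (S t x - x - ((t : ℝ) : 𝕜) • y))
    (by simp [hS.zero]) (fun s h hh hst => ?_) hb
  have hsplit : S (s + h) x - x - (((s + h : ℝ≥0) : ℝ) : 𝕜) • y =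
      (S s x - x - ((s : ℝ) : 𝕜) • y) +
        ((h : ℝ) : 𝕜) • (S s (diffQuotient S x h - y) + (S s y - y)) := by
    rw [hS.add, mul_apply_eq_comp]
    nth_rw 1 [← sub_add_cancel (S h x) x]
    rw [← smul_diffQuotient S x hh]
    simp only [map_add, map_sub, map_smul, NNReal.coe_add]
    module
  calc p (S (s + h) x - x - (((s + h : ℝ≥0) : ℝ) : 𝕜) • y)
      ≤ p (S s x - x - ((s : ℝ) : 𝕜) • y) +
          h * p (S s (diffQuotient S x h - y) + (S s y - y)) := by
        rw [hsplit, ← seminorm_ofReal_smul (𝕜 := 𝕜) p h.coe_nonneg]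
        exact map_add_le_add p _ _
    _ ≤ p (S s x - x - ((s : ℝ) : 𝕜) • y) + h * (p (diffQuotient S x h - y) + c) := by
        gcongr
        exact (map_add_le_add p _ _).trans
          (add_le_add (hS.contraction s p hp _) (hc s (le_self_add.trans hst)))

theorem of_tendsto {l : Filter ι} [l.NeBot] (hN : IsNorming Γ) {S : ι → ℝ≥0 → X →L[𝕜] X}
    (hS : ∀ i, IsSeminormContractionSemigroup Γ (S i)) {T : ℝ≥0 → X →L[𝕜] X}
    (hT : ∀ t x, SeminormTendsto Γ (fun i => S i t x) l (T t x)) :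
    IsSeminormContractionSemigroup Γ T where
  zero := ContinuousLinearMap.ext fun x =>
    (hT 0 x).unique hN (by simpa [(hS _).zero] using SeminormTendsto.const x)
  add s t := ContinuousLinearMap.ext fun x => by
    refine (hT (s + t) x).unique hN ?_
    simpa [(hS _).add] using (hT s (T t x)).map_contraction (fun i => (hS i).contraction s) (hT t x)
  contraction t := .of_tendsto (fun i => (hS i).contraction t) (hT t)

end IsSeminormContractionSemigroup

/-- A Trotter–Kato argument: `hSy` makes the difference quotients of the `S i` converge uniformly
in `i`. -/
theorem HasOrbitDeriv.of_tendsto {l : Filter ι} [l.NeBot] {S : ι → ℝ≥0 → X →L[𝕜] X}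
    (hS : ∀ i, IsSeminormContractionSemigroup Γ (S i)) {u v : ι → X}
    (huv : ∀ i, HasOrbitDeriv Γ (S i) (u i) (v i))
    (hu : SeminormTendsto Γ u l x) (hv : SeminormTendsto Γ v l y)
    {T : ℝ≥0 → X →L[𝕜] X} (hT : ∀ t, SeminormTendsto Γ (fun i => S i t (u i)) l (T t x))
    (hSy : SeminormTendsto Γ (fun q : ℝ≥0 × ι => S q.2 q.1 y) (𝓝 0 ×ˢ ⊤) y) :
    HasOrbitDeriv Γ T x y := by
  refine seminormTendsto_iff_eventually_le.2 fun p hp ε hε => ?_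
  have hsmall := seminormTendsto_iff_eventually_le.1 hSy p hp ε hε
  rw [← principal_univ, eventually_prod_principal_iff] at hsmall
  obtain ⟨δ, hδ, hδε⟩ := NNReal.nhds_zero_basis.eventually_iff.1 hsmall
  filter_upwards [Ioo_mem_nhdsGT hδ] with t ht
  have hbound i : p (S i t (u i) - u i - ((t : ℝ) : 𝕜) • v i) ≤ t * (ε + 2 * p (v i - y)) := by
    refine (hS i).apply_sub_sub_smul_le (huv i) hp fun s hs => ?_
    have hsplit : S i s (v i) - v i = S i s (v i - y) + (S i s y - y) + (y - v i) := by
      rw [map_sub]; abel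
    calc p (S i s (v i) - v i) ≤ p (S i s (v i - y)) + p (S i s y - y) + p (y - v i) := by
          rw [hsplit]
          exact (map_add_le_add p _ _).trans (add_le_add_left (map_add_le_add p _ _) _)
      _ ≤ p (v i - y) + ε + p (v i - y) := by
          rw [map_sub_rev p y]
          gcongr
          · exact (hS i).contraction s p hp _
          · exact hδε (hs.trans_lt ht.2) i (mem_univ i)
      _ = ε + 2 * p (v i - y) := by ring
  have hlim : p (T t x - x - ((t : ℝ) : 𝕜) • y) ≤ t * ε := by
    refine le_of_tendsto_of_tendsto' ((((hT t).sub hu).sub (hv.smul _)).tendsto_apply hp) ?_ hbound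
    simpa using (((hv p hp).const_mul 2).const_add ε).const_mul (t : ℝ)
  rw [← smul_diffQuotient T x ht.1, ← smul_sub, seminorm_ofReal_smul p t.coe_nonneg] at hlim
  exact le_of_mul_le_mul_left hlim ht.1

end Semigroup

section PoissonGenerator

variable {𝕜 X : Type*} [RCLike 𝕜] [NormedAddCommGroup X] [NormedSpace 𝕜 X]
  {Γ : Set (Seminorm 𝕜 X)} {N N' : X →L[𝕜] X} {S : ℝ≥0 → X →L[𝕜] X} {c c' : ℝ} {x y : X}

/-- The bounded operator `c (N - 1)`, generator of the compound Poisson semigroup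
`e^{-ct} ∑ (ct)^n / n! N^n` of rate `c` and jumps `N`. Yosida approximations and difference
quotients of semigroups have this form. -/
noncomputable def poissonGenerator (c : ℝ) (N : X →L[𝕜] X) : X →L[𝕜] X :=
  (c : 𝕜) • (N - 1)

theorem diffQuotient_eq_poissonGenerator (S : ℝ≥0 → X →L[𝕜] X) (x : X) (t : ℝ≥0) :
    diffQuotient S x t = poissonGenerator (t : ℝ)⁻¹ (S t) x := by
  simp [diffQuotient, poissonGenerator]

theorem commute_poissonGenerator (h : Commute N N') (c c' : ℝ) :
    Commute (poissonGenerator c N) (poissonGenerator c' N') :=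
  (((h.sub_right (.one_right N)).sub_left (.one_left _)).smul_right _).smul_left _

theorem mul_le_apply_sub_poissonGenerator {p : Seminorm 𝕜 X} (hp : ∀ x, p (N x) ≤ p x)
    (hc : 0 ≤ c) {r : ℝ} (hr : 0 ≤ r) (x : X) :
    r * p x ≤ p ((r : 𝕜) • x - poissonGenerator c N x) := by
  have hsplit : ((r + c : ℝ) : 𝕜) • x =
      ((r : 𝕜) • x - poissonGenerator c N x) + (c : 𝕜) • N x := by
    simp only [poissonGenerator, smul_apply, sub_apply, one_apply_eq_self, map_add]
    module
  have h : (r + c) * p x ≤ p ((r : 𝕜) • x - poissonGenerator c N x) + c * p x := by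
    rw [← seminorm_ofReal_smul (𝕜 := 𝕜) p (add_nonneg hr hc), hsplit]
    refine (map_add_le_add p _ _).trans (add_le_add_right ?_ _)
    rw [seminorm_ofReal_smul p hc]
    exact mul_le_mul_of_nonneg_left (hp x) hc
  linarith

theorem IsSeminormContractionSemigroup.mul_le_apply_sub (hS : IsSeminormContractionSemigroup Γ S)
    (hx : HasOrbitDeriv Γ S x y) {p : Seminorm 𝕜 X} (hp : p ∈ Γ) {r : ℝ} (hr : 0 ≤ r) :
    r * p x ≤ p ((r : 𝕜) • x - y) := by
  refine ge_of_tendsto' ((SeminormTendsto.sub (.const _) hx).tendsto_apply hp) fun t => ?_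
  rw [diffQuotient_eq_poissonGenerator]
  exact mul_le_apply_sub_poissonGenerator (hS.contraction t p hp)
    (inv_nonneg.2 t.coe_nonneg) hr x

section Resolvent

theorem commute_ringInverse {R : Type*} [MonoidWithZero R] {a b : R} (h : Commute a b)
    (hb : IsUnit b) : Commute a (Ring.inverse b) := by
  obtain ⟨b, rfl⟩ := hb
  rw [Ring.inverse_unit]
  exact h.units_inv_right

variable [CompleteSpace X]

theorem isUnit_one_sub_poissonGenerator (hN : ‖N‖ ≤ 1) (hc : 0 ≤ c) :
    IsUnit (1 - poissonGenerator c N) := by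
  have hc1 : ((1 + c : ℝ) : 𝕜) ≠ 0 := by exact_mod_cast (by positivity : 1 + c ≠ 0)
  have heq : 1 - poissonGenerator c N =
      Units.mk0 _ hc1 • (1 - ((c / (1 + c) : ℝ) : 𝕜) • N) := by
    rw [Units.smul_mk0, smul_sub, smul_smul, ← RCLike.ofReal_mul,
      mul_div_cancel₀ c (by positivity), poissonGenerator, RCLike.ofReal_add, RCLike.ofReal_one]
    module
  rw [heq]
  refine (isUnit_one_sub_of_norm_lt_one ?_).smul _
  calc ‖((c / (1 + c) : ℝ) : 𝕜) • N‖ = c / (1 + c) * ‖N‖ := by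
        rw [norm_smul, RCLike.norm_of_nonneg (by positivity)]
    _ ≤ c / (1 + c) := mul_le_of_le_one_right (by positivity) hN
    _ < 1 := (div_lt_one (by positivity)).2 (by linarith)

theorem isSeminormContraction_inverse_one_sub_poissonGenerator (hΓ : IsNorming Γ)
    (hN : IsSeminormContraction Γ N) (hc : 0 ≤ c) :
    IsSeminormContraction Γ (Ring.inverse (1 - poissonGenerator c N)) := fun p hp x => by
  have hunit := isUnit_one_sub_poissonGenerator (hN.norm_le_one hΓ) hc
  set J := Ring.inverse (1 - poissonGenerator c N)
  have hJ : J x - poissonGenerator c N (J x) = x :=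
    DFunLike.congr_fun (Ring.mul_inverse_cancel _ hunit) x
  simpa [hJ] using mul_le_apply_sub_poissonGenerator (hN p hp) hc zero_le_one (J x)

theorem seminorm_inverse_sub_inverse_le (hΓ : IsNorming Γ) (hN : IsSeminormContraction Γ N)
    (hN' : IsSeminormContraction Γ N') (hNN' : Commute N N') (hc : 0 ≤ c) (hc' : 0 ≤ c')
    {p : Seminorm 𝕜 X} (hp : p ∈ Γ) (x : X) :
    p (Ring.inverse (1 - poissonGenerator c N) x - Ring.inverse (1 - poissonGenerator c' N') x) ≤
      p (poissonGenerator c N x - poissonGenerator c' N' x) := by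
  have hunit := isUnit_one_sub_poissonGenerator (hN.norm_le_one hΓ) hc
  have hunit' := isUnit_one_sub_poissonGenerator (hN'.norm_le_one hΓ) hc'
  set B := poissonGenerator c N
  set B' := poissonGenerator c' N'
  have hcomm : Commute (B - B') (Ring.inverse (1 - B')) :=
    commute_ringInverse (.sub_right (.one_right _)
      ((commute_poissonGenerator hNN' c c').sub_left (.refl B'))) hunit'
  have hJ : Ring.inverse (1 - B) - Ring.inverse (1 - B') =
      Ring.inverse (1 - B) * (Ring.inverse (1 - B') * (B - B')) := by
    rw [Ring.inverse_sub_inverse (iff_of_true hunit hunit'), sub_sub_sub_cancel_left, mul_assoc,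
      hcomm.eq]
  have hJx := DFunLike.congr_fun hJ x
  rw [_root_.sub_apply] at hJx
  rw [hJx]
  exact (isSeminormContraction_inverse_one_sub_poissonGenerator hΓ hN hc p hp _).trans
    (isSeminormContraction_inverse_one_sub_poissonGenerator hΓ hN' hc' p hp _)

end Resolvent

section Exponential

/-- The semigroup `t ↦ e^{tB}` generated by a bounded operator `B`. -/
noncomputable def expSemigroup (B : X →L[𝕜] X) (t : ℝ≥0) : X →L[𝕜] X :=
  NormedSpace.exp (((t : ℝ) : 𝕜) • B)

theorem commute_expSemigroup {B B' : X →L[𝕜] X} (h : Commute B B') (s t : ℝ≥0) :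
    Commute (expSemigroup B s) (expSemigroup B' t) :=
  ((h.smul_left _).smul_right _).exp

variable [CompleteSpace X]

theorem seminorm_exp_smul_le (hΓ : IsNorming Γ) (hN : IsSeminormContraction Γ N)
    {p : Seminorm 𝕜 X} (hp : p ∈ Γ) {r : ℝ} (hr : 0 ≤ r) (x : X) :
    p (NormedSpace.exp ((r : 𝕜) • N) x) ≤ Real.exp r * p x := by
  have hop : HasSum (fun n : ℕ => ((n.factorial : 𝕜)⁻¹ • ((r : 𝕜) • N) ^ n) x)
      (NormedSpace.exp ((r : 𝕜) • N) x) :=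
    (NormedSpace.exp_series_hasSum_exp' (𝕂 := 𝕜) ((r : 𝕜) • N)).map
      (ContinuousLinearMap.apply 𝕜 X x) (ContinuousLinearMap.continuous _)
  have hreal : HasSum (fun n : ℕ => r ^ n / n.factorial * p x) (Real.exp r * p x) := by
    rw [Real.exp_eq_exp_ℝ]
    exact (NormedSpace.expSeries_div_hasSum_exp r).mul_right _
  have hterm (n : ℕ) : p (((n.factorial : 𝕜)⁻¹ • ((r : 𝕜) • N) ^ n) x) ≤
      r ^ n / n.factorial * p x := by
    have hsmul : ((n.factorial : 𝕜)⁻¹ • ((r : 𝕜) • N) ^ n) x =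
        ((r ^ n / n.factorial : ℝ) : 𝕜) • (N ^ n) x := by
      rw [smul_pow, smul_smul]
      simp [div_eq_inv_mul]
    rw [hsmul, seminorm_ofReal_smul p (by positivity)]
    gcongr
    exact hN.pow n p hp x
  refine le_of_tendsto_of_tendsto' (((hΓ.continuous hp).tendsto _).comp hop) hreal fun s => ?_
  exact (Finset.le_sum_of_subadditive p (map_zero p).le (map_add_le_add p) _ _).trans
    (Finset.sum_le_sum fun n _ => hterm n)

theorem expSemigroup_poissonGenerator (c : ℝ) (N : X →L[𝕜] X) (t : ℝ≥0) :
    expSemigroup (poissonGenerator c N) t =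
      ((Real.exp (-(t * c)) : ℝ) : 𝕜) • NormedSpace.exp (((t * c : ℝ) : 𝕜) • N) := by
  let : NormedAlgebra ℚ (X →L[𝕜] X) := .restrictScalars ℚ 𝕜 _
  have hsplit : ((t : ℝ) : 𝕜) • poissonGenerator c N =
      algebraMap 𝕜 (X →L[𝕜] X) ((-(t * c) : ℝ) : 𝕜) + ((t * c : ℝ) : 𝕜) • N := by
    rw [Algebra.algebraMap_eq_smul_one, poissonGenerator]
    push_cast
    module
  have hexp : NormedSpace.exp ((-(t * c) : ℝ) : 𝕜) = ((Real.exp (-(t * c)) : ℝ) : 𝕜) := by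
    rw [Real.exp_eq_exp_ℝ]
    exact (NormedSpace.algebraMap_exp_comm (𝔸 := 𝕜) (-(t * c) : ℝ)).symm
  rw [expSemigroup, hsplit, NormedSpace.exp_add_of_commute (Algebra.commutes _ _),
    ← NormedSpace.algebraMap_exp_comm, hexp, Algebra.algebraMap_eq_smul_one, smul_mul_assoc,
    one_mul]

theorem isSeminormContractionSemigroup_expSemigroup (hΓ : IsNorming Γ)
    (hN : IsSeminormContraction Γ N) (hc : 0 ≤ c) :
    IsSeminormContractionSemigroup Γ (expSemigroup (poissonGenerator c N)) where
  zero := by rw [expSemigroup, NNReal.coe_zero, RCLike.ofReal_zero, zero_smul, NormedSpace.exp_zero]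
  add s t := by
    let : NormedAlgebra ℚ (X →L[𝕜] X) := .restrictScalars ℚ 𝕜 _
    rw [expSemigroup, NNReal.coe_add, RCLike.ofReal_add, add_smul]
    exact NormedSpace.exp_add_of_commute (((Commute.refl _).smul_left _).smul_right _)
  contraction t p hp x := by
    rw [expSemigroup_poissonGenerator, smul_apply, seminorm_ofReal_smul p (Real.exp_pos _).le]
    calc Real.exp (-(t * c)) * p (NormedSpace.exp (((t * c : ℝ) : 𝕜) • N) x)
        ≤ Real.exp (-(t * c)) * (Real.exp (t * c) * p x) := by
          gcongr
          exact seminorm_exp_smul_le hΓ hN hp (mul_nonneg t.coe_nonneg hc) x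
      _ = p x := by rw [← mul_assoc, ← Real.exp_add, neg_add_cancel, Real.exp_zero, one_mul]

theorem hasOrbitDeriv_expSemigroup (hΓ : IsNorming Γ) (B : X →L[𝕜] X) (x : X) :
    HasOrbitDeriv Γ (expSemigroup B) x (B x) := by
  have hderiv : HasDerivAt (fun z : 𝕜 => NormedSpace.exp (z • B) x) (B x) 0 := by
    have h := hasDerivAt_exp_smul_const (𝕂 := 𝕜) B 0
    rw [zero_smul, NormedSpace.exp_zero, one_mul] at h
    exact (ContinuousLinearMap.apply 𝕜 X x).hasFDerivAt.comp_hasDerivAt (0 : 𝕜) h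
  have hcoe : Tendsto (fun t : ℝ≥0 => ((t : ℝ) : 𝕜)) (𝓝[>] 0) (𝓝[≠] 0) := by
    have hcont : Continuous fun t : ℝ≥0 => ((t : ℝ) : 𝕜) := by fun_prop
    refine tendsto_nhdsWithin_iff.2
      ⟨by simpa using (hcont.tendsto 0).mono_left nhdsWithin_le_nhds, ?_⟩
    filter_upwards [self_mem_nhdsWithin] with t ht
    simpa using ht.ne'
  refine SeminormTendsto.of_tendsto hΓ <|
    ((hasDerivAt_iff_tendsto_slope_zero.1 hderiv).comp hcoe).congr fun t => ?_
  simp [diffQuotient, expSemigroup]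

end Exponential

end PoissonGenerator

section PoissonApproximation

variable {𝕜 X : Type*} [RCLike 𝕜] [NormedAddCommGroup X] [NormedSpace 𝕜 X]
  {Γ : Set (Seminorm 𝕜 X)} {A : X →ₗ.[𝕜] X} {c : ℕ → ℝ} {N : ℕ → X →L[𝕜] X}

/-- The commuting bounded operators `c n (N n - 1)`, with `N n` contractive, converge to `A` on its
domain. -/
structure IsPoissonApproximation (Γ : Set (Seminorm 𝕜 X)) (A : X →ₗ.[𝕜] X) (c : ℕ → ℝ)
    (N : ℕ → X →L[𝕜] X) : Prop where
  nonneg : ∀ n, 0 ≤ c n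
  contraction : ∀ n, IsSeminormContraction Γ (N n)
  commute : ∀ m n, Commute (N m) (N n)
  tendsto : ∀ z : A.domain,
    SeminormTendsto Γ (fun n => poissonGenerator (c n) (N n) (z : X)) atTop (A z)

namespace IsPoissonApproximation

variable [CompleteSpace X] (hB : IsPoissonApproximation Γ A c N) (hΓ : IsNorming Γ)
  (hD : IsSeminormDense Γ A.domain)

include hB hΓ

theorem isSeminormContractionSemigroup (n : ℕ) :
    IsSeminormContractionSemigroup Γ (expSemigroup (poissonGenerator (c n) (N n))) :=
  isSeminormContractionSemigroup_expSemigroup hΓ (hB.contraction n) (hB.nonneg n)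

theorem cauchy_expSemigroup (t : ℝ≥0) (z : A.domain) :
    SeminormTendsto Γ (fun q : ℕ × ℕ => expSemigroup (poissonGenerator (c q.1) (N q.1)) t (z : X) -
      expSemigroup (poissonGenerator (c q.2) (N q.2)) t (z : X)) atTop 0 := by
  have hscaled := (hB.tendsto z).cauchy.smul ((t : ℝ) : 𝕜)
  rw [smul_zero] at hscaled
  refine hscaled.of_le fun p hp q => ?_
  rw [sub_zero, sub_zero, seminorm_ofReal_smul p t.coe_nonneg]
  exact (hB.isSeminormContractionSemigroup hΓ q.1).apply_sub_apply_le
    (hB.isSeminormContractionSemigroup hΓ q.2)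
    (commute_expSemigroup (commute_poissonGenerator (hB.commute _ _) _ _))
    (hasOrbitDeriv_expSemigroup hΓ _ _) (hasOrbitDeriv_expSemigroup hΓ _ _) hp t

theorem cauchy_inverse (z : A.domain) :
    SeminormTendsto Γ (fun q : ℕ × ℕ =>
      Ring.inverse (1 - poissonGenerator (c q.1) (N q.1)) (z : X) -
        Ring.inverse (1 - poissonGenerator (c q.2) (N q.2)) (z : X)) atTop 0 := by
  refine (hB.tendsto z).cauchy.of_le fun p hp q => ?_
  rw [sub_zero, sub_zero]
  exact seminorm_inverse_sub_inverse_le hΓ (hB.contraction q.1) (hB.contraction q.2)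
    (hB.commute _ _) (hB.nonneg _) (hB.nonneg _) hp (z : X)

include hD

theorem tendsto_expSemigroup_zero (x : X) :
    SeminormTendsto Γ (fun q : ℝ≥0 × ℕ => expSemigroup (poissonGenerator (c q.2) (N q.2)) q.1 x)
      (𝓝 0 ×ˢ ⊤) x := by
  refine seminormTendsto_self_of_dense hD
    (S := fun q : ℝ≥0 × ℕ => expSemigroup (poissonGenerator (c q.2) (N q.2)) q.1)
    (fun q => (hB.isSeminormContractionSemigroup hΓ q.2).contraction q.1) (fun z hz p hp => ?_) x
  obtain ⟨M, hM⟩ := ((hB.tendsto ⟨z, hz⟩).tendsto_apply hp).bddAbove_range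
  have hlim : Tendsto (fun q : ℝ≥0 × ℕ => (q.1 : ℝ) * M) (𝓝 0 ×ˢ ⊤) (𝓝 0) := by
    simpa using ((NNReal.continuous_coe.tendsto 0).comp tendsto_fst).mul_const M
  refine squeeze_zero (fun _ => apply_nonneg p _) (fun q => ?_) hlim
  calc p (expSemigroup (poissonGenerator (c q.2) (N q.2)) q.1 z - z)
      ≤ q.1 * p (poissonGenerator (c q.2) (N q.2) z) :=
        (hB.isSeminormContractionSemigroup hΓ q.2).apply_sub_self_le
          (hasOrbitDeriv_expSemigroup hΓ _ _) hp q.1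
    _ ≤ q.1 * M := by gcongr; exact hM (mem_range_self q.2)

variable (hC : IsBoundedlyComplete Γ)

include hC

theorem exists_semigroup : ∃ T : ℝ≥0 → X →L[𝕜] X, IsSeminormContractionSemigroup Γ T ∧
    (∀ x, SeminormTendsto Γ (fun t => T t x) (𝓝 0) x) ∧
    ∀ z : A.domain, HasOrbitDeriv Γ T z (A z) := by
  have hS := hB.isSeminormContractionSemigroup hΓ
  have hlim (t : ℝ≥0) := exists_limit_operator_of_dense hΓ hC hD (fun n => (hS n).contraction t)
    fun v hv => hB.cauchy_expSemigroup hΓ t ⟨v, hv⟩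
  choose T hT using hlim
  have hzero := hB.tendsto_expSemigroup_zero hΓ hD
  exact ⟨T, .of_tendsto hΓ hS hT, fun x => (hzero x).of_prod_top fun t => hT t x,
    fun z => .of_tendsto hS (fun n => hasOrbitDeriv_expSemigroup hΓ _ _) (.const _)
      (hB.tendsto z) (fun t => hT t z) (hzero _)⟩

theorem exists_resolvent : ∃ K : X →L[𝕜] X, IsSeminormContraction Γ K ∧
    (∀ L, IsSeminormContraction Γ L → (∀ n, Commute L (N n)) → Commute L K) ∧
    ∀ z : A.domain, K (z - A z) = z := by
  have hJ n := isSeminormContraction_inverse_one_sub_poissonGenerator hΓ (hB.contraction n)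
    (hB.nonneg n)
  have hunit n := isUnit_one_sub_poissonGenerator ((hB.contraction n).norm_le_one hΓ) (hB.nonneg n)
  obtain ⟨K, hK⟩ := exists_limit_operator_of_dense hΓ hC hD hJ
    fun v hv => hB.cauchy_inverse hΓ ⟨v, hv⟩
  refine ⟨K, .of_tendsto hJ hK, fun L hL hLN => ?_, fun z => ?_⟩
  · have hcomm n : Commute L (Ring.inverse (1 - poissonGenerator (c n) (N n))) :=
      commute_ringInverse (.sub_right (.one_right _)
        (((hLN n).sub_right (.one_right _)).smul_right _)) (hunit n)
    refine ContinuousLinearMap.ext fun x => ((hK x).map hL).unique hΓ ?_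
    have hLx n : L (Ring.inverse (1 - poissonGenerator (c n) (N n)) x) =
        Ring.inverse (1 - poissonGenerator (c n) (N n)) (L x) := DFunLike.congr_fun (hcomm n).eq x
    simpa only [hLx, mul_apply_eq_comp] using hK (L x)
  · have hinv n : Ring.inverse (1 - poissonGenerator (c n) (N n))
        (z - poissonGenerator (c n) (N n) z) = z :=
      DFunLike.congr_fun (Ring.inverse_mul_cancel _ (hunit n)) (z : X)
    refine ((hK _).map_contraction hJ ((SeminormTendsto.const _).sub (hB.tendsto z))).unique hΓ ?_
    simpa only [hinv] using SeminormTendsto.const _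

end IsPoissonApproximation

end PoissonApproximation

section Generator

variable {𝕜 X : Type*} [RCLike 𝕜] [NormedAddCommGroup X] [NormedSpace 𝕜 X]
  {Γ : Set (Seminorm 𝕜 X)} {A : X →ₗ.[𝕜] X} {T : ℝ≥0 → X →L[𝕜] X}

/-- `A` is the generator of `T` with respect to `Γ`: its graph consists of the pairs `(x, y)` for
which the orbit of `x` has derivative `y` at time `0`. -/
def IsSeminormGenerator (Γ : Set (Seminorm 𝕜 X)) (T : ℝ≥0 → X →L[𝕜] X) (A : X →ₗ.[𝕜] X) : Prop :=
  ∀ x y, (x, y) ∈ A.graph ↔ HasOrbitDeriv Γ T x y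

/-- `λ - A` is bounded below by `λ` for every `λ > 0` and every seminorm in `Γ`. -/
def IsSeminormDissipative (Γ : Set (Seminorm 𝕜 X)) (A : X →ₗ.[𝕜] X) : Prop :=
  ∀ l : ℝ, 0 < l → ∀ p ∈ Γ, ∀ z : A.domain, l * p (z : X) ≤ p (shift A l z)

namespace IsSeminormGenerator

variable (hA : IsSeminormGenerator Γ T A) (hT : IsSeminormContractionSemigroup Γ T)

include hA

theorem hasOrbitDeriv (z : A.domain) : HasOrbitDeriv Γ T z (A z) :=
  (hA _ _).1 (A.mem_graph z)

include hT

theorem isSeminormDissipative : IsSeminormDissipative Γ A := fun _ hl _ hp z =>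
  hT.mul_le_apply_sub (hA.hasOrbitDeriv z) hp hl.le

theorem isPoissonApproximation :
    IsPoissonApproximation Γ A (fun n => ((1 / (n + 1) : ℝ≥0) : ℝ)⁻¹) fun n => T (1 / (n + 1)) where
  nonneg _ := inv_nonneg.2 (NNReal.coe_nonneg _)
  contraction _ := hT.contraction _
  commute _ _ := hT.commute _ _
  tendsto z := by
    simpa only [diffQuotient_eq_poissonGenerator] using
      SeminormTendsto.comp (hA.hasOrbitDeriv z) (tendsto_div_nat_nhdsGT one_pos)

theorem surjective_shift_one [CompleteSpace X] (hΓ : IsNorming Γ)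
    (hD : IsSeminormDense Γ A.domain) (hC : IsBoundedlyComplete Γ)
    (hT₀ : ∀ x, SeminormTendsto Γ (fun t => T t x) (𝓝 0) x) :
    Function.Surjective (shift A 1) := fun x => by
  obtain ⟨K, hK, hKcomm, hKA⟩ := (hA.isPoissonApproximation hT).exists_resolvent hΓ hD hC
  have hKT t : Commute K (T t) :=
    (hKcomm _ (hT.contraction t) fun _ => hT.commute _ _).symm
  have hdomain (z : A.domain) : HasOrbitDeriv Γ T (K z) (K z - z) := by
    have hKz : K z - K (A z) = z := by simpa using hKA z
    rw [sub_eq_of_eq_add (sub_eq_iff_eq_add'.1 hKz)]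
    exact (hA.hasOrbitDeriv z).map hK hKT
  obtain ⟨l, hl, hlx⟩ := hD x
  have hgraph : (K x, K x - x) ∈ A.graph := (hA _ _).2 <|
    .of_tendsto (fun _ => hT) hdomain (hlx.map hK) ((hlx.map hK).sub hlx)
      (fun t => (hlx.map hK).map (hT.contraction t)) ((hT₀ _).comp tendsto_fst)
  obtain ⟨z, hz, hAz⟩ := A.mem_graph_iff.1 hgraph
  exact ⟨z, by simp only [shift, hz, hAz]; simp⟩

end IsSeminormGenerator

theorem isSeminormGenerator_of_surjective_shift (hΓ : IsNorming Γ)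
    (hT : IsSeminormContractionSemigroup Γ T) (hA : ∀ z : A.domain, HasOrbitDeriv Γ T z (A z))
    {l : ℝ} (hl : 0 < l) (hs : Function.Surjective (shift A l)) :
    IsSeminormGenerator Γ T A := fun x y => by
  constructor
  · intro hxy
    obtain ⟨z, rfl, rfl⟩ := A.mem_graph_iff.1 hxy
    exact hA z
  · intro hxy
    obtain ⟨z, hz⟩ := hs ((l : 𝕜) • x - y)
    have hzero : (l : 𝕜) • ((z : X) - x) - (A z - y) = 0 := by
      rw [smul_sub, sub_sub_sub_comm]
      exact sub_eq_zero.2 hz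
    have hzx : (z : X) = x := sub_eq_zero.1 <| hΓ.eq_zero fun p hp => by
      have h := hT.mul_le_apply_sub ((hA z).sub hxy) hp hl.le
      rw [hzero, map_zero] at h
      exact nonpos_of_mul_nonpos_right h hl
    rw [hzx, sub_self, smul_zero, zero_sub, neg_eq_zero, sub_eq_zero] at hzero
    exact A.mem_graph_iff.2 ⟨z, hzx, hzero⟩

end Generator

section Yosida

variable {𝕜 X : Type*} [RCLike 𝕜] [NormedAddCommGroup X] [NormedSpace 𝕜 X]
  {Γ : Set (Seminorm 𝕜 X)} {A : X →ₗ.[𝕜] X} {R R' : X →L[𝕜] X} {l m : ℝ}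

/-- `R` is the resolvent `(l - A)⁻¹`. -/
structure IsResolventAt (A : X →ₗ.[𝕜] X) (l : ℝ) (R : X →L[𝕜] X) : Prop where
  mem_domain : ∀ x, R x ∈ A.domain
  shift_apply : ∀ x, shift A l ⟨R x, mem_domain x⟩ = x
  apply_shift : ∀ z, R (shift A l z) = z

theorem shift_eq_shift_add (A : X →ₗ.[𝕜] X) (l m : ℝ) (z : A.domain) :
    shift A m z = shift A l z + ((m - l : ℝ) : 𝕜) • (z : X) := by
  rw [shift, shift, RCLike.ofReal_sub, sub_smul]
  abel

namespace IsResolventAt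

theorem smul_apply_sub (hR : IsResolventAt A l R) (z : A.domain) :
    (l : 𝕜) • R z - z = R (A z) := by
  have h := hR.apply_shift z
  rwa [shift, map_sub, map_smul, sub_eq_iff_eq_add, ← sub_eq_iff_eq_add'] at h

theorem sub_eq_smul_mul (hR : IsResolventAt A l R) (hR' : IsResolventAt A m R') :
    R' - R = ((l - m : ℝ) : 𝕜) • (R * R') := ContinuousLinearMap.ext fun x => by
  have h := hR.apply_shift ⟨R' x, hR'.mem_domain x⟩
  rw [shift_eq_shift_add A m l, hR'.shift_apply, map_add, map_smul] at h
  exact sub_eq_of_eq_add' h.symm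

theorem commute (hR : IsResolventAt A l R) (hR' : IsResolventAt A m R') : Commute R R' := by
  obtain rfl | hlm := eq_or_ne l m
  · have h := hR.sub_eq_smul_mul hR'
    rw [sub_self, RCLike.ofReal_zero, zero_smul, sub_eq_zero] at h
    rw [h]
  · have h : ((l - m : ℝ) : 𝕜) • (R * R') = ((l - m : ℝ) : 𝕜) • (R' * R) := by
      rw [← hR.sub_eq_smul_mul hR', ← neg_sub m l, RCLike.ofReal_neg, neg_smul,
        ← hR'.sub_eq_smul_mul hR, neg_sub]
    exact smul_right_injective _ (RCLike.ofReal_ne_zero.2 (sub_ne_zero.2 hlm)) h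

theorem isSeminormContraction (hR : IsResolventAt A l R) (hA : IsSeminormDissipative Γ A)
    (hl : 0 < l) : IsSeminormContraction Γ ((l : 𝕜) • R) := fun p hp x => by
  rw [smul_apply, seminorm_ofReal_smul p hl.le]
  simpa only [hR.shift_apply] using hA l hl p hp ⟨R x, hR.mem_domain x⟩

theorem surjective_shift [CompleteSpace X] (hR : IsResolventAt A l R) (hRl : ‖(l : 𝕜) • R‖ ≤ 1)
    (hm : 0 < m) (hml : m < 2 * l) : Function.Surjective (shift A m) := fun x => by
  have hl : 0 < l := by linarith
  have hnorm : ‖((l - m : ℝ) : 𝕜) • R‖ < 1 := by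
    calc ‖((l - m : ℝ) : 𝕜) • R‖ = |l - m| / l * ‖(l : 𝕜) • R‖ := by
          rw [norm_smul, norm_smul, RCLike.norm_ofReal, RCLike.norm_of_nonneg hl.le]
          field_simp
      _ ≤ |l - m| / l := mul_le_of_le_one_right (by positivity) hRl
      _ < 1 := (div_lt_one hl).2 (abs_sub_lt_iff.2 ⟨by linarith, by linarith⟩)
  have hunit := isUnit_one_sub_of_norm_lt_one hnorm
  set y := Ring.inverse (1 - ((l - m : ℝ) : 𝕜) • R) x
  have hy : y - ((l - m : ℝ) : 𝕜) • R y = x :=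
    DFunLike.congr_fun (Ring.mul_inverse_cancel _ hunit) x
  refine ⟨⟨R y, hR.mem_domain y⟩, ?_⟩
  rw [shift_eq_shift_add A l m, hR.shift_apply, ← neg_sub l m, RCLike.ofReal_neg, neg_smul,
    ← sub_eq_add_neg]
  exact hy

end IsResolventAt

namespace IsSeminormDissipative

variable (hA : IsSeminormDissipative Γ A) (hΓ : IsNorming Γ)

include hA

theorem tendsto_smul_resolvent (hD : IsSeminormDense Γ A.domain) {R : ℕ → X →L[𝕜] X}
    (hR : ∀ n : ℕ, IsResolventAt A (n + 1) (R n)) (x : X) :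
    SeminormTendsto Γ (fun n : ℕ => (((n + 1 : ℝ) : 𝕜) • R n) x) atTop x := by
  have hcontr n := (hR n).isSeminormContraction hA n.cast_add_one_pos
  refine seminormTendsto_self_of_dense hD hcontr (fun v hv p hp => ?_) x
  have hlim : Tendsto (fun n : ℕ => 1 / (n + 1 : ℝ) * p (A ⟨v, hv⟩)) atTop (𝓝 0) := by
    simpa using tendsto_one_div_add_atTop_nhds_zero_nat.mul_const (p (A ⟨v, hv⟩))
  refine squeeze_zero (fun _ => apply_nonneg p _) (fun n => ?_) hlim
  have hpos : (0 : ℝ) < n + 1 := n.cast_add_one_pos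
  have hsub : (((n + 1 : ℝ) : 𝕜) • R n) v - v = R n (A ⟨v, hv⟩) := (hR n).smul_apply_sub ⟨v, hv⟩
  rw [hsub, one_div_mul_eq_div, le_div_iff₀' hpos, ← seminorm_ofReal_smul (𝕜 := 𝕜) p hpos.le]
  exact hcontr n p hp _

theorem isPoissonApproximation_yosida (hD : IsSeminormDense Γ A.domain) {R : ℕ → X →L[𝕜] X}
    (hR : ∀ n : ℕ, IsResolventAt A (n + 1) (R n)) :
    IsPoissonApproximation Γ A (fun n => n + 1) fun n => ((n + 1 : ℝ) : 𝕜) • R n where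
  nonneg n := by positivity
  contraction n := (hR n).isSeminormContraction hA n.cast_add_one_pos
  commute m n := (((hR m).commute (hR n)).smul_left _).smul_right _
  tendsto z := by
    have hyosida (n : ℕ) : poissonGenerator (n + 1 : ℝ) (((n + 1 : ℝ) : 𝕜) • R n) (z : X) =
        (((n + 1 : ℝ) : 𝕜) • R n) (A z) :=
      congrArg _ ((hR n).smul_apply_sub z)
    simpa only [hyosida] using hA.tendsto_smul_resolvent hD hR (A z)

include hΓ

theorem exists_isResolventAt (hl : 0 < l) (hs : Function.Surjective (shift A l)) :
    ∃ R : X →L[𝕜] X, IsResolventAt A l R := by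
  let L : A.domain →ₗ[𝕜] X := (l : 𝕜) • A.domain.subtype - A.toFun
  have hbelow (z : A.domain) : ‖(z : X)‖ ≤ l⁻¹ * ‖L z‖ := hΓ.norm_le fun p hp => by
    rw [← div_eq_inv_mul, le_div_iff₀' hl]
    exact (hA l hl p hp z).trans (hΓ.le_norm hp _)
  have hL : Function.Injective L := (injective_iff_map_eq_zero L).2 fun z hz => by
    simpa [hz] using hbelow z
  let e : A.domain ≃ₗ[𝕜] X := .ofBijective L ⟨hL, hs⟩
  refine ⟨(A.domain.subtype ∘ₗ e.symm).mkContinuous l⁻¹ fun x => ?_, fun x => (e.symm x).2,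
    e.apply_symm_apply, fun z => congrArg Subtype.val (e.symm_apply_apply z)⟩
  have hx : L (e.symm x) = x := e.apply_symm_apply x
  exact (hbelow (e.symm x)).trans_eq (by rw [hx])

theorem surjective_shift [CompleteSpace X] (hl : 0 < l) (hs : Function.Surjective (shift A l))
    (hm : 0 < m) : Function.Surjective (shift A m) := by
  have hstep {r s : ℝ} (hr : 0 < r) (hsurj : Function.Surjective (shift A r)) (hs : 0 < s)
      (hsr : s < 2 * r) : Function.Surjective (shift A s) := by
    obtain ⟨R, hR⟩ := hA.exists_isResolventAt hΓ hr hsurj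
    exact hR.surjective_shift ((hR.isSeminormContraction hA hr).norm_le_one hΓ) hs hsr
  have hpow (n : ℕ) : Function.Surjective (shift A (l * (3 / 2) ^ n)) := by
    induction n with
    | zero => simpa using hs
    | succ n ih =>
      have hpos : 0 < l * (3 / 2) ^ n := by positivity
      exact hstep hpos ih (by positivity) (by rw [pow_succ]; linarith)
  obtain ⟨n, hn⟩ := pow_unbounded_of_one_lt (m / l) (by norm_num : (1 : ℝ) < 3 / 2)
  rw [div_lt_iff₀' hl] at hn
  exact hstep (by positivity) (hpow n) hm (by linarith)

theorem exists_semigroup [CompleteSpace X] (hD : IsSeminormDense Γ A.domain)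
    (hC : IsBoundedlyComplete Γ) (hl : 0 < l) (hs : Function.Surjective (shift A l)) :
    ∃ T : ℝ≥0 → X →L[𝕜] X, IsSeminormContractionSemigroup Γ T ∧
      (∀ x, SeminormTendsto Γ (fun t => T t x) (𝓝 0) x) ∧ IsSeminormGenerator Γ T A := by
  have hR (n : ℕ) := hA.exists_isResolventAt hΓ n.cast_add_one_pos
    (hA.surjective_shift hΓ hl hs n.cast_add_one_pos)
  choose R hR using hR
  obtain ⟨T, hT, hT₀, hTA⟩ := (hA.isPoissonApproximation_yosida hD hR).exists_semigroup hΓ hD hC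
  exact ⟨T, hT, hT₀, isSeminormGenerator_of_surjective_shift hΓ hT hTA hl hs⟩

end IsSeminormDissipative

end Yosida

section SecondTopology

variable {𝕜 X : Type*} [RCLike 𝕜] [NormedAddCommGroup X] [NormedSpace 𝕜 X]
  {τ : SecondTopology X} (hτ : IsBiAdmissible 𝕜 τ) {Γ : Set (Seminorm 𝕜 X)}
  (hfund : IsFundamentalSystem τ Γ) {A : X →ₗ.[𝕜] X} {T : ℝ≥0 → X →L[𝕜] X}

theorem IsBiDenselyDefined.dense (hA : IsBiDenselyDefined τ A) :
    @Dense X τ.top (A.domain : Set X) := fun x => by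
  obtain ⟨u, hu, -, hux⟩ := hA x
  exact @mem_closure_of_tendsto X τ.top _ _ _ _ _ _ hux (.of_forall hu)

include hτ hfund

theorem tendsto_iff_seminormTendsto {ι : Type*} {l : Filter ι} {u : ι → X} {x : X} :
    Tendsto u l (@nhds X τ.top x) ↔ SeminormTendsto Γ u l x := by
  have hgroup : @IsTopologicalAddGroup X τ.top _ := by
    let := τ.top
    have := hτ.locallyConvex
    exact (PolynormableSpace.withSeminorms 𝕜 X).topologicalAddGroup
  rw [← @tendsto_sub_nhds_zero_iff X _ τ.top hgroup]
  constructor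
  · intro h p hp
    have hp0 := @Continuous.tendsto _ _ τ.top _ _ (hfund.1 p hp) 0
    rw [map_zero] at hp0
    exact hp0.comp h
  · intro h U hU
    obtain ⟨p, hp, ε, hε, hball⟩ := hfund.2 U hU
    exact ((h p hp).eventually_lt_const hε).mono fun i hi => hball hi

theorem isBoundedlyComplete : IsBoundedlyComplete Γ := fun u hu hcauchy => by
  obtain ⟨x, hx⟩ := hτ.seqComplete u hu fun U hU =>
    eventually_atTop_prod_self'.1 ((tendsto_iff_seminormTendsto hτ hfund).2 hcauchy hU)
  exact ⟨x, (tendsto_iff_seminormTendsto hτ hfund).1 hx⟩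

theorem isSeminormDense_of_dense {D : Set X} (hD : @Dense X τ.top D) : IsSeminormDense Γ D :=
  fun x => ⟨comap Subtype.val (@nhds X τ.top x),
    (@mem_closure_iff_comap_neBot X τ.top x D).1 (hD x),
    (tendsto_iff_seminormTendsto hτ hfund).1 tendsto_comap⟩

theorem IsBiContinuousSemigroup.seminormTendsto_zero (hT : IsBiContinuousSemigroup τ T) (x : X) :
    SeminormTendsto Γ (fun t => T t x) (𝓝 0) x := by
  have h := @Continuous.tendsto _ _ _ τ.top _ (hT.stronglyContinuous x) 0
  rwa [hT.zero, tendsto_iff_seminormTendsto hτ hfund] at h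

namespace IsSeminormContractionSemigroup

variable (hT : IsSeminormContractionSemigroup Γ T)

include hT

omit hτ hfund in
theorem seminormTendsto_nhds (hT₀ : ∀ x, SeminormTendsto Γ (fun t => T t x) (𝓝 0) x) (s : ℝ≥0)
    (x : X) : SeminormTendsto Γ (fun t => T t x) (𝓝 s) (T s x) := by
  have hdiff : Tendsto (fun t => (t - s) + (s - t)) (𝓝 s) (𝓝 0) := by
    have hcont : Continuous fun t : ℝ≥0 => (t - s) + (s - t) := by fun_prop
    simpa using hcont.tendsto s
  refine ((hT₀ x).comp hdiff).of_le fun p hp t => ?_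
  have hle {a b : ℝ≥0} (hab : a ≤ b) : p (T b x - T a x) ≤ p (T (b - a) x - x) := by
    have hsplit : T b x - T a x = T a (T (b - a) x - x) := by
      rw [map_sub, ← mul_apply_eq_comp, ← hT.add, add_tsub_cancel_of_le hab]
    exact hsplit ▸ hT.contraction a p hp _
  rcases le_total s t with h | h
  · simpa [tsub_eq_zero_of_le h] using hle h
  · simpa [tsub_eq_zero_of_le h, map_sub_rev p (T t x)] using hle h

theorem isBiContinuousSemigroup (hΓ : IsNorming Γ)
    (hT₀ : ∀ x, SeminormTendsto Γ (fun t => T t x) (𝓝 0) x) : IsBiContinuousSemigroup τ T where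
  zero := hT.zero
  add := hT.add
  stronglyContinuous x := (@continuous_iff_continuousAt _ _ _ τ.top _).2 fun t =>
    (tendsto_iff_seminormTendsto hτ hfund).2 (hT.seminormTendsto_nhds hT₀ t x)
  expBounded := ⟨1, 0, le_rfl, fun t => by simpa using (hT.contraction t).norm_le_one hΓ⟩
  locallyBiEquicontinuous u _ hu t₀ U hU := by
    obtain ⟨p, hp, ε, hε, hball⟩ := hfund.2 U hU
    have hlim := ((tendsto_iff_seminormTendsto hτ hfund).1 hu).tendsto_apply hp
    rw [map_zero] at hlim
    filter_upwards [hlim.eventually_lt_const hε] with n hn s _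
    exact hball ((hT.contraction s p hp _).trans_lt hn)

theorem isGenerator_iff (hΓ : IsNorming Γ) : IsGenerator τ T A ↔ IsSeminormGenerator Γ T A := by
  have hderiv {x y : X} : Tendsto (diffQuotient T x) (𝓝[>] 0) (@nhds X τ.top y) ↔
      HasOrbitDeriv Γ T x y := tendsto_iff_seminormTendsto hτ hfund
  have hbound {x y : X} (h : HasOrbitDeriv Γ T x y) (t : ℝ≥0) (ht : 0 < t) :
      ‖T t x - x‖ / t ≤ ‖y‖ := by
    rw [div_le_iff₀' (by exact_mod_cast ht)]
    refine hΓ.norm_le fun p hp => (hT.apply_sub_self_le h hp t).trans ?_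
    gcongr
    exact hΓ.le_norm hp y
  constructor
  · refine fun hA x y => ⟨fun hxy => ?_, fun hxy => ?_⟩
    · obtain ⟨z, rfl, rfl⟩ := A.mem_graph_iff.1 hxy
      exact hderiv.1 (hA.2 z)
    · have hx : x ∈ A.domain :=
        (hA.1 x).2 ⟨⟨y, hderiv.2 hxy⟩, ‖y‖, fun t ht _ => hbound hxy t ht⟩
      have hAx : A ⟨x, hx⟩ = y := SeminormTendsto.unique hΓ (hderiv.1 (hA.2 ⟨x, hx⟩)) hxy
      exact A.mem_graph_iff.2 ⟨⟨x, hx⟩, rfl, hAx⟩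
  · refine fun hA => ⟨fun x => ⟨fun hx => ?_, ?_⟩, fun z => hderiv.2 (hA.hasOrbitDeriv z)⟩
    · have hxA := hA.hasOrbitDeriv ⟨x, hx⟩
      exact ⟨⟨A ⟨x, hx⟩, hderiv.2 hxA⟩, ‖A ⟨x, hx⟩‖, fun t ht _ => hbound hxA t ht⟩
    · rintro ⟨⟨y, hxy⟩, -⟩
      exact A.mem_domain_of_mem_graph ((hA x y).2 (hderiv.1 hxy))

end IsSeminormContractionSemigroup

end SecondTopology

end BiContinuous

open BiContinuous in
theorem proposition3p10_general {𝕜 X : Type*} [RCLike 𝕜] [NormedAddCommGroup X] [NormedSpace 𝕜 X]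
    (τ : SecondTopology X) (hτ : IsBiAdmissible 𝕜 τ)
    (A : X →ₗ.[𝕜] X) (hdense : @Dense X τ.top (A.domain : Set X)) :
    (∃ T : ℝ≥0 → X →L[𝕜] X,
      IsBiContinuousSemigroup τ T ∧ IsContractive T ∧ IsGenerator τ T A ∧
      ∃ Γ : Set (Seminorm 𝕜 X), IsFundamentalSystem τ Γ ∧ IsNorming Γ ∧
        ∀ t : ℝ≥0, ∀ p ∈ Γ, ∀ x : X, p (T t x) ≤ p x) ↔
    (IsBiDissipative τ A ∧ ∃ l : ℝ, 0 < l ∧ Function.Surjective (shift A l)) := by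
  have := hτ.complete
  constructor
  · rintro ⟨T, hT, -, hA, Γ, hfund, hΓ, hcontr⟩
    have hTΓ : IsSeminormContractionSemigroup Γ T := ⟨hT.zero, hT.add, hcontr⟩
    have hAΓ := (hTΓ.isGenerator_iff hτ hfund hΓ).1 hA
    exact ⟨⟨Γ, hfund, hAΓ.isSeminormDissipative hTΓ, hΓ⟩, 1, one_pos,
      hAΓ.surjective_shift_one hTΓ hΓ (isSeminormDense_of_dense hτ hfund hdense)
        (isBoundedlyComplete hτ hfund) (hT.seminormTendsto_zero hτ hfund)⟩
  · rintro ⟨⟨Γ, hfund, hA, hΓ⟩, l, hl, hs⟩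
    obtain ⟨T, hT, hT₀, hTA⟩ := IsSeminormDissipative.exists_semigroup hA hΓ
      (isSeminormDense_of_dense hτ hfund hdense) (isBoundedlyComplete hτ hfund) hl hs
    exact ⟨T, hT.isBiContinuousSemigroup hτ hfund hΓ hT₀,
      fun t => (hT.contraction t).norm_le_one hΓ, (hT.isGenerator_iff hτ hfund hΓ).2 hTA,
      Γ, hfund, hΓ, hT.contraction⟩

open BiContinuous in
theorem proposition3p10 {𝕜 X : Type*} [RCLike 𝕜] [NormedAddCommGroup X] [NormedSpace 𝕜 X]
    (τ : SecondTopology X) (hτ : IsBiAdmissible 𝕜 τ)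
    (A : X →ₗ.[𝕜] X) (hdense : IsBiDenselyDefined τ A) (hclosed : A.IsClosed) :
    (∃ T : ℝ≥0 → X →L[𝕜] X,
      IsBiContinuousSemigroup τ T ∧ IsContractive T ∧ IsGenerator τ T A ∧
      ∃ Γ : Set (Seminorm 𝕜 X), IsFundamentalSystem τ Γ ∧ IsNorming Γ ∧
        ∀ t : ℝ≥0, ∀ p ∈ Γ, ∀ x : X, p (T t x) ≤ p x) ↔
    (IsBiDissipative τ A ∧ ∃ l : ℝ, 0 < l ∧ Function.Surjective (shift A l)) :=
  proposition3p10_general τ hτ A hdense.dense
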